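/- There are an absolute constant $C$, a function $\eta(n) = o(1)$ and a function $\delta(n) = o(n^{-1})$ (as $n \to \infty$) such that the following holds for every $\varepsilon \ge 0$, every integer $n \ge 2$ and every $p \in [0,1]$ with $$\frac{2000 \log n}{n} \le p \le n^{-\frac12 - \varepsilon}.$$ Let $G \sim G(n,p)$ be the binomial (Erdős–Rényi–Gilbert) random graph on $n$ vertices, let $\Delta = (n-1)p$, and let $d$ denote the graph distance in $G$. For distinct vertices $u,v$ let $W_{uv}$ be the set of witnesses of $uv$, that is, of vertices $s$ whose distances to $u$ and to $v$ in $G$ are both finite and satisfy $|d(s,u) - d(s,v)| \ge 2$. Then, with probability at least $1 - \delta(n)$, the set $$\mathcal{E} = \left\{ uv \notin E(G) \;:\; |W_{uv}| \ge \left(\tfrac12 - \eta(n)\right) \frac{n}{\Delta^2} \right\}$$ of unordered pairs of distinct non-adjacent vertices satisfies $$|\mathcal{E}| \ge \binom n2 - C\, n \Delta^2 .$$ -/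

import Mathlib

open Filter Asymptotics
open scoped Topology

namespace RandomGraphWitness

/-- `s` is a witness of the pair `u, v` in `G` if `|d(s,u) - d(s,v)| ≥ 2`. Both distances are
required to be finite, so that the default value `0` of `SimpleGraph.dist` between vertices of
different components never produces a witness. -/
def IsWitness {V : Type*} (G : SimpleGraph V) (u v s : V) : Prop :=
  G.Reachable s u ∧ G.Reachable s v ∧ 2 ≤ |(G.dist s u : ℤ) - (G.dist s v : ℤ)|

/-- The set `W_{uv}` of witnesses of the pair `u, v`. -/
def witnesses {V : Type*} (G : SimpleGraph V) (u v : V) : Set V :=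
  {s | IsWitness G u v s}

/-- The unordered pairs of distinct vertices that are non-edges of `G` and have at least
`t` witnesses. -/
def wellWitnessed {V : Type*} (G : SimpleGraph V) (t : ℝ) : Set (Sym2 V) :=
  {e | ∃ u v : V, e = s(u, v) ∧ u ≠ v ∧ ¬ G.Adj u v ∧ t ≤ ((witnesses G u v).ncard : ℝ)}

/-- The expected average degree `Δ = (n - 1) p` of `G(n, p)`. -/
def expDeg (n : ℕ) (p : ℝ) : ℝ := ((n : ℝ) - 1) * p

end RandomGraphWitness

/-! Write D = np. If D² > n/100, the error term 400nΔ² exceeds the number of pairs and nothing is to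
be shown. If D² ≤ n/100, then with high probability every non-adjacent pair has enough witnesses, so
only the edges are lost, and there are at most n · `sphereBound D 1` of them.

To find witnesses of uv, grow breadth-first layers from u and discard, at each step, the vertices
too close to v. In a connected graph the vertices of `front G u v i` are at distance i from u and at
least i + 2 from v. The discarded balls have at most 13/10 · D^(i+2) vertices, so the fronts keep
growing by roughly a factor D up to the radius j with D^(j+1) ≤ 2n/5 < D^(j+2) (`exists_radius`).
There the front has at least 0.26 n/D² vertices (`le_frontBound`). The fronts grown from u and from
v are disjoint, and their total 0.52 n/D² beats n/(2Δ²), so η = 0 suffices.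

The random input is `real_exposed_le`. Expose the edges touching the vertices at distance < i from u
or < i + 2 from v. The front at radius i avoids both balls, so its edges to the outside are still
fresh, and a Chernoff bound controls the next front. Spheres are bounded above in the same way. At
radius i the allowed relative error is 2^(-i)/10: these errors are summable, while the expected
sizes grow fast enough to keep every failure probability below n^(-8). A union bound over O(n³)
events finishes (`real_not_regular_le`). -/

namespace RandomGraphWitness

open MeasureTheory ProbabilityTheory

/-! ### Independence of edges and exposure of a random history -/

section Independence

variable {V : Type*} [Finite V]

/-- All sets of simple graphs on a finite vertex type are measurable. -/
instance discreteMeasurableSpace_simpleGraph : DiscreteMeasurableSpace (SimpleGraph V) where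
  forall_measurableSet s := by
    have h : MeasurableSet (SimpleGraph.edgeSet '' s) := MeasurableSet.of_discrete
    have := SimpleGraph.measurable_edgeSet h
    rwa [Set.preimage_image_eq _ SimpleGraph.edgeSet_injective] at this

instance finite_simpleGraph : Finite (SimpleGraph V) :=
  Finite.of_injective _ (SimpleGraph.edgeSet_injective (V := V))

/-- `G` and `G'` have the same edges inside `E`. -/
def AgreeOn (E : Set (Sym2 V)) (G G' : SimpleGraph V) : Prop :=
  ∀ e ∈ E, e ∈ G.edgeSet ↔ e ∈ G'.edgeSet

/-- `f` depends only on which elements of `E` are edges. -/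
def DeterminedBy {α : Type*} (f : SimpleGraph V → α) (E : Set (Sym2 V)) : Prop :=
  ∀ G G', AgreeOn E G G' → f G = f G'

/-- The random graph is the image of a product measure on `Sym2 V`, and each edge indicator reads a
single coordinate, forced to be false on the diagonal. -/
lemma iIndepFun_mem_edgeSet (p : unitInterval) :
    iIndepFun (fun (e : Sym2 V) (G : SimpleGraph V) => e ∈ G.edgeSet)
      (SimpleGraph.binomialRandom V p) := by
  have hX := iIndepFun_infinitePi (P := fun e : Sym2 V =>
    unitInterval.toNNReal p • Measure.dirac (e ∈ (Sym2.diagSetᶜ : Set (Sym2 V))) +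
      unitInterval.toNNReal (unitInterval.symm p) • Measure.dirac False)
    (X := fun e (P : Prop) => P ∧ ¬ e.IsDiag) (fun e => Measurable.of_discrete)
  rw [iIndepFun_iff_map_fun_eq_infinitePi_map (fun e => Measurable.of_discrete)] at hX ⊢
  rw [SimpleGraph.binomialRandom_eq_map, setBernoulli_eq_map,
    Measure.map_map SimpleGraph.measurable_fromEdgeSet (by fun_prop),
    Measure.map_map Measurable.of_discrete Measurable.of_discrete]
  refine Eq.trans ?_ (hX.trans (congrArg Measure.infinitePi (funext fun e => ?_)))
  · simp [Function.comp_def]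
  · rw [Measure.map_map Measurable.of_discrete Measurable.of_discrete]
    simp [Function.comp_def]

lemma binomialRandom_real_mem_edgeSet (p : unitInterval) {e : Sym2 V} (he : ¬ e.IsDiag) :
    (SimpleGraph.binomialRandom V p).real {G | e ∈ G.edgeSet} = p := by
  have h := Measure.infinitePi_map_eval (fun e : Sym2 V =>
    unitInterval.toNNReal p • Measure.dirac (e ∈ (Sym2.diagSetᶜ : Set (Sym2 V))) +
      unitInterval.toNNReal (unitInterval.symm p) • Measure.dirac False) e
  have h2 := congrArg (fun m => m {True}) h
  rw [Measure.map_apply (by fun_prop) MeasurableSet.of_discrete] at h2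
  rw [SimpleGraph.binomialRandom_eq_map, setBernoulli_eq_map,
    Measure.map_map SimpleGraph.measurable_fromEdgeSet (by fun_prop), measureReal_def,
    Measure.map_apply Measurable.of_discrete MeasurableSet.of_discrete]
  have h3 : (SimpleGraph.fromEdgeSet ∘ fun p : Sym2 V → Prop => {i | p i}) ⁻¹'
      {G | e ∈ G.edgeSet} = (fun x => x e) ⁻¹' {True} := by
    ext ω
    simp [he]
  rw [h3, h2]
  simp [he]

/-- Each function factors through the edge indicators of its own set, all other pairs being filled
in as non-edges. Disjoint subfamilies of an independent family are independent. -/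
lemma integral_mul_of_determinedBy (p : unitInterval) {f g : SimpleGraph V → ℝ}
    {E F : Set (Sym2 V)} (hf : DeterminedBy f E) (hg : DeterminedBy g F) (hEF : Disjoint E F) :
    ∫ G, f G * g G ∂(SimpleGraph.binomialRandom V p) =
      (∫ G, f G ∂(SimpleGraph.binomialRandom V p)) *
        ∫ G, g G ∂(SimpleGraph.binomialRandom V p) := by
  classical
  have key : ∀ (f : SimpleGraph V → ℝ) (E : Set (Sym2 V)), DeterminedBy f E →
      f = (fun r : E.toFinite.toFinset → Prop =>
          f (SimpleGraph.fromEdgeSet {e | ∃ h : e ∈ E.toFinite.toFinset, r ⟨e, h⟩})) ∘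
        fun G e => (e : Sym2 V) ∈ G.edgeSet := by
    intro f E hf
    funext G
    apply hf
    intro e he
    have h2 : e ∈ G.edgeSet → e ∉ Sym2.diagSet := fun h => by
      simpa using G.not_isDiag_of_mem_edgeSet h
    simp only [SimpleGraph.edgeSet_fromEdgeSet, Set.mem_sdiff]
    constructor
    · intro h
      exact ⟨⟨by simpa using he, h⟩, h2 h⟩
    · rintro ⟨⟨_, h⟩, _⟩
      exact h
  have hi := (iIndepFun_mem_edgeSet (V := V) p).indepFun_finset E.toFinite.toFinset
    F.toFinite.toFinset (by simpa [Set.Finite.disjoint_toFinset] using hEF)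
    (fun e => Measurable.of_discrete)
  have hj := hi.comp (φ := fun r => f (SimpleGraph.fromEdgeSet
      {e | ∃ h : e ∈ E.toFinite.toFinset, r ⟨e, h⟩}))
    (ψ := fun r => g (SimpleGraph.fromEdgeSet
      {e | ∃ h : e ∈ F.toFinite.toFinset, r ⟨e, h⟩})) Measurable.of_discrete Measurable.of_discrete
  rw [← key f E hf, ← key g F hg] at hj
  exact hj.integral_mul_eq_mul_integral Measurable.of_discrete.aestronglyMeasurable
    Measurable.of_discrete.aestronglyMeasurable

lemma integral_prod_of_determinedBy (p : unitInterval) {ι : Type*} (I : Finset ι)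
    (f : ι → SimpleGraph V → ℝ) (E : ι → Set (Sym2 V)) (hf : ∀ i ∈ I, DeterminedBy (f i) (E i))
    (hE : ∀ i ∈ I, ∀ j ∈ I, i ≠ j → Disjoint (E i) (E j)) :
    ∫ G, ∏ i ∈ I, f i G ∂(SimpleGraph.binomialRandom V p) =
      ∏ i ∈ I, ∫ G, f i G ∂(SimpleGraph.binomialRandom V p) := by
  classical
  induction I using Finset.induction_on with
  | empty => simp
  | insert a I ha ih =>
    simp_rw [Finset.prod_insert ha]
    rw [integral_mul_of_determinedBy p (hf a (by simp)) (F := ⋃ i ∈ I, E i)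
      (g := fun G => ∏ i ∈ I, f i G), ih]
    · exact fun i hi => hf i (by simp [hi])
    · exact fun i hi j hj => hE i (by simp [hi]) j (by simp [hj])
    · intro G G' h
      refine Finset.prod_congr rfl fun i hi => hf i (by simp [hi]) G G' fun e he => h e ?_
      simp only [Set.mem_iUnion]
      exact ⟨i, hi, he⟩
    · rw [Set.disjoint_iUnion₂_right]
      intro i hi
      exact hE a (by simp) i (by simp [hi]) (by rintro rfl; exact ha hi)

lemma integral_ite_eq (p : unitInterval) (A : Set (SimpleGraph V)) [DecidablePred (· ∈ A)]
    (a b : ℝ) :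
    ∫ G, (if G ∈ A then a else b) ∂(SimpleGraph.binomialRandom V p) =
      b + (SimpleGraph.binomialRandom V p).real A * (a - b) := by
  have h : ∀ G : SimpleGraph V, (if G ∈ A then a else b) = b + A.indicator (fun _ => a - b) G := by
    intro G
    by_cases h : G ∈ A <;> simp [h]
  simp_rw [h]
  rw [integral_add (integrable_const _) (Integrable.of_finite), integral_indicator_const _
    MeasurableSet.of_discrete]
  simp

lemma real_inter_of_determinedBy (p : unitInterval) {A B : Set (SimpleGraph V)}
    {E F : Set (Sym2 V)} (hA : DeterminedBy (· ∈ A) E) (hB : DeterminedBy (· ∈ B) F)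
    (hEF : Disjoint E F) :
    (SimpleGraph.binomialRandom V p).real (A ∩ B) =
      (SimpleGraph.binomialRandom V p).real A * (SimpleGraph.binomialRandom V p).real B := by
  classical
  have h := integral_mul_of_determinedBy p (f := fun G => if G ∈ A then 1 else 0)
    (g := fun G => if G ∈ B then 1 else 0) (E := E) (F := F)
    (fun G G' h => by simp only [hA G G' h]) (fun G G' h => by simp only [hB G G' h]) hEF
  rw [integral_ite_eq, integral_ite_eq] at h
  have h2 := integral_ite_eq p (A ∩ B) 1 0
  have h3 : ∀ G : SimpleGraph V, (if G ∈ A ∩ B then (1 : ℝ) else 0) =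
      (if G ∈ A then 1 else 0) * (if G ∈ B then 1 else 0) := by
    intro G
    by_cases hA : G ∈ A <;> by_cases hB : G ∈ B <;> simp [hA, hB]
  simp_rw [h3] at h2
  rw [h] at h2
  simpa using h2.symm

/-- Exposing a history: if the value `h` of `F` is determined by edges that do not influence the
event `B h`, then `B (F G)` is no more likely than the likeliest of the events `B h`. -/
lemma real_history_le (p : unitInterval) {H : Type*} (F : SimpleGraph V → H)
    (B : H → Set (SimpleGraph V)) (E : H → Set (Sym2 V)) (K : Set H)
    (hF : ∀ G G', AgreeOn (E (F G)) G G' → F G' = F G)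
    (hB : ∀ h ∈ Set.range F, h ∈ K → DeterminedBy (· ∈ B h) (E h)ᶜ) {β : ℝ}
    (hβ : ∀ h ∈ Set.range F, h ∈ K → (SimpleGraph.binomialRandom V p).real (B h) ≤ β)
    (hβ0 : 0 ≤ β) :
    (SimpleGraph.binomialRandom V p).real {G | F G ∈ K ∧ G ∈ B (F G)} ≤ β := by
  classical
  set μ := SimpleGraph.binomialRandom V p
  have : IsProbabilityMeasure μ :=
    inferInstanceAs (IsProbabilityMeasure (SimpleGraph.binomialRandom V p))
  have hfin : (Set.range F).Finite := Set.finite_range F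
  let R := hfin.toFinset.filter (· ∈ K)
  have h1 : {G | F G ∈ K ∧ G ∈ B (F G)} ⊆ ⋃ h ∈ R, ({G | F G = h} ∩ B h) := by
    rintro G ⟨h1, h2⟩
    simp only [Set.mem_iUnion]
    exact ⟨F G, by simp [R, h1], rfl, h2⟩
  have h2 : ∀ h ∈ R, μ.real ({G | F G = h} ∩ B h) ≤ μ.real {G | F G = h} * β := by
    intro h hh
    have hr : h ∈ Set.range F := by
      have := (Finset.mem_filter.1 hh).1
      simpa using this
    have hk : h ∈ K := (Finset.mem_filter.1 hh).2
    -- The fibre of `F` over `h` is itself decided by the pairs in `E h`: this is `hF`, used from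
    -- either graph. Hence it is independent of `B h`.
    rw [real_inter_of_determinedBy p (E := E h) (F := (E h)ᶜ) _ (hB h hr hk) disjoint_compl_right]
    · exact mul_le_mul_of_nonneg_left (hβ h hr hk) measureReal_nonneg
    · intro G G' hG
      simp only [Set.mem_ofPred_eq, eq_iff_iff]
      constructor
      · rintro rfl
        exact hF G G' hG
      · rintro rfl
        exact hF G' G fun e he => (hG e he).symm
  calc μ.real {G | F G ∈ K ∧ G ∈ B (F G)} ≤ μ.real (⋃ h ∈ R, ({G | F G = h} ∩ B h)) :=
        measureReal_mono h1 (measure_ne_top _ _)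
    _ ≤ ∑ h ∈ R, μ.real ({G | F G = h} ∩ B h) := measureReal_biUnion_finset_le _ _
    _ ≤ ∑ h ∈ R, μ.real {G | F G = h} * β := Finset.sum_le_sum h2
    _ = μ.real (⋃ h ∈ R, {G | F G = h}) * β := by
        rw [measureReal_biUnion_finset _ (fun _ _ => MeasurableSet.of_discrete), Finset.sum_mul]
        intro a _ b _ hab
        simp only [Function.onFun, Set.disjoint_left, Set.mem_ofPred_eq]
        rintro G rfl h
        exact hab h
    _ ≤ 1 * β := mul_le_mul_of_nonneg_right measureReal_le_one hβ0
    _ = β := one_mul _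

end Independence

/-! ### Chernoff bounds for the neighbourhood of a fixed set -/

section Neighbourhood

open Classical in
/-- The vertices of `Z` that have a neighbour in `T`. -/
noncomputable def nbrsIn {V : Type*} (G : SimpleGraph V) (T Z : Finset V) : Finset V :=
  Z.filter fun z => ∃ t ∈ T, G.Adj t z

variable {V : Type*}

/-- The pairs between `T` and `z`. -/
def pairsTo (T : Finset V) (z : V) : Set (Sym2 V) := {e | ∃ t ∈ T, e = s(t, z)}

lemma disjoint_pairsTo {T Z : Finset V} (h : Disjoint T Z) {z z' : V} (hz' : z' ∈ Z)
    (hne : z ≠ z') : Disjoint (pairsTo T z) (pairsTo T z') := by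
  rw [Set.disjoint_left]
  rintro e ⟨t, ht, rfl⟩ ⟨t', ht', he⟩
  rw [Finset.disjoint_left] at h
  rcases Sym2.eq_iff.1 he with ⟨_, h2⟩ | ⟨h1, _⟩
  · exact hne h2
  · exact h (h1 ▸ ht) hz'

lemma determinedBy_exists_adj (T : Finset V) (z : V) :
    DeterminedBy (fun G : SimpleGraph V => ∃ t ∈ T, G.Adj t z) (pairsTo T z) := by
  intro G G' h
  have : ∀ t ∈ T, (G.Adj t z ↔ G'.Adj t z) := fun t ht => h s(t, z) ⟨t, ht, rfl⟩
  simp only [eq_iff_iff]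
  constructor
  · rintro ⟨t, ht, h⟩
    exact ⟨t, ht, (this t ht).1 h⟩
  · rintro ⟨t, ht, h⟩
    exact ⟨t, ht, (this t ht).2 h⟩

variable [Finite V]

lemma real_exists_adj (p : unitInterval) {T : Finset V} {z : V} (hz : z ∉ T) :
    (SimpleGraph.binomialRandom V p).real {G | ∃ t ∈ T, G.Adj t z} =
      1 - (1 - (p : ℝ)) ^ T.card := by
  classical
  have h1 : ∀ t ∈ T, ∫ G, (if G ∈ {G : SimpleGraph V | s(t, z) ∈ G.edgeSet} then (0 : ℝ) else 1)
      ∂(SimpleGraph.binomialRandom V p) = 1 - p := by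
    intro t ht
    rw [integral_ite_eq, binomialRandom_real_mem_edgeSet]
    · ring
    · simp only [Sym2.mk_isDiag_iff]
      rintro rfl
      exact hz ht
  have h2 := integral_prod_of_determinedBy p T
    (fun t (G : SimpleGraph V) =>
      if G ∈ {G : SimpleGraph V | s(t, z) ∈ G.edgeSet} then (0 : ℝ) else 1)
    (fun t => {s(t, z)})
    (fun t _ G G' h => by simp only [Set.mem_ofPred_eq, h s(t, z) rfl])
    (by
      intro t _ t' _ hne
      simp only [Set.disjoint_singleton, ne_eq, Sym2.eq_iff]
      rintro (⟨h, _⟩ | ⟨h, h'⟩)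
      · exact hne h
      · exact hne (h.trans h'))
  rw [Finset.prod_congr rfl h1, Finset.prod_const] at h2
  have h3 : ∀ G : SimpleGraph V, ∏ t ∈ T, (if G ∈ {G : SimpleGraph V | s(t, z) ∈ G.edgeSet} then
      (0 : ℝ) else 1) = if G ∈ {G : SimpleGraph V | ∃ t ∈ T, G.Adj t z} then 0 else 1 := by
    intro G
    split_ifs with h
    · obtain ⟨t, ht, h⟩ := h
      exact Finset.prod_eq_zero ht (by simp [h])
    · refine Finset.prod_eq_one fun t ht => ?_
      rw [if_neg]
      exact fun h' => h ⟨t, ht, h'⟩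
  simp_rw [h3] at h2
  rw [integral_ite_eq] at h2
  linarith

/-- For disjoint T and Z, different z ∈ Z look at disjoint sets of pairs. The count is therefore
binomial with success probability 1 - (1 - p)^|T|, and this is its generating function. -/
lemma integral_pow_nbrsIn (p : unitInterval) {T Z : Finset V} (h : Disjoint T Z) (τ : ℝ) :
    ∫ G, τ ^ (nbrsIn G T Z).card ∂(SimpleGraph.binomialRandom V p) =
      (1 + (1 - (1 - (p : ℝ)) ^ T.card) * (τ - 1)) ^ Z.card := by
  classical
  have h2 := integral_prod_of_determinedBy p Z
    (fun z (G : SimpleGraph V) =>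
      if G ∈ {G : SimpleGraph V | ∃ t ∈ T, G.Adj t z} then τ else 1)
    (pairsTo T)
    (fun z _ G G' h => by
      have := determinedBy_exists_adj T z G G' h
      simp only [Set.mem_ofPred_eq, this])
    (fun z _ z' hz' hne => disjoint_pairsTo h hz' hne)
  have h1 : ∀ z ∈ Z, ∫ G, (if G ∈ {G : SimpleGraph V | ∃ t ∈ T, G.Adj t z} then τ else 1)
      ∂(SimpleGraph.binomialRandom V p) = 1 + (1 - (1 - (p : ℝ)) ^ T.card) * (τ - 1) := by
    intro z hz
    rw [integral_ite_eq, real_exists_adj]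
    exact Finset.disjoint_right.1 h hz
  rw [Finset.prod_congr rfl h1, Finset.prod_const] at h2
  rw [← h2]
  congr 1
  funext G
  rw [nbrsIn, ← Finset.prod_const, Finset.prod_filter]
  rfl

lemma integral_pow_nbrsIn_le (p : unitInterval) {T Z : Finset V} (h : Disjoint T Z) {τ : ℝ}
    (hτ : 0 ≤ τ) :
    ∫ G, τ ^ (nbrsIn G T Z).card ∂(SimpleGraph.binomialRandom V p) ≤
      Real.exp (Z.card * (1 - (1 - (p : ℝ)) ^ T.card) * (τ - 1)) := by
  rw [integral_pow_nbrsIn p h, mul_assoc, Real.exp_nat_mul]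
  have h0 : 0 ≤ (1 - (p : ℝ)) ^ T.card := pow_nonneg (by linarith [p.2.2]) _
  have h1 : (1 - (p : ℝ)) ^ T.card ≤ 1 :=
    pow_le_one₀ (by linarith [p.2.2]) (by linarith [p.2.1])
  refine pow_le_pow_left₀ ?_ ?_ _
  · nlinarith
  · linarith [Real.add_one_le_exp ((1 - (1 - (p : ℝ)) ^ T.card) * (τ - 1))]

lemma real_le_of_integral_le (p : unitInterval) {A : Set (SimpleGraph V)} {f : SimpleGraph V → ℝ}
    {c b : ℝ} (hf : ∀ G, 0 ≤ f G) (hc : ∀ G ∈ A, Real.exp c ≤ f G)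
    (hb : ∫ G, f G ∂(SimpleGraph.binomialRandom V p) ≤ Real.exp b) :
    (SimpleGraph.binomialRandom V p).real A ≤ Real.exp (b - c) := by
  classical
  have h1 := integral_ite_eq p A (Real.exp c) 0
  have h2 : ∫ G, (if G ∈ A then Real.exp c else 0) ∂(SimpleGraph.binomialRandom V p) ≤
      ∫ G, f G ∂(SimpleGraph.binomialRandom V p) := by
    refine integral_mono Integrable.of_finite Integrable.of_finite fun G => ?_
    by_cases h : G ∈ A
    · simpa [h] using hc G h
    · simpa [h] using hf G
  rw [Real.exp_sub, le_div_iff₀ (Real.exp_pos _)]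
  linarith

/-- Multiply by the quadratic lower bound for exp y: (1 - y + y²/2)(1 + y + y²/2) = 1 + y⁴/4 ≥ 1. -/
lemma exp_neg_le_quadratic {y : ℝ} (hy : 0 ≤ y) : Real.exp (-y) ≤ 1 - y + y ^ 2 / 2 := by
  have h1 := Real.quadratic_le_exp_of_nonneg hy
  rw [Real.exp_neg, inv_le_iff_one_le_mul₀ (Real.exp_pos _)]
  have h2 : 0 < 1 - y + y ^ 2 / 2 := by nlinarith [sq_nonneg (1 - y)]
  nlinarith [mul_le_mul_of_nonneg_left h1 h2.le, sq_nonneg (y ^ 2)]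

/-- Lower tail bound for the number of vertices of `Z` with a neighbour in `T`. -/
lemma real_card_nbrsIn_lt_le (p : unitInterval) {T Z : Finset V} (h : Disjoint T Z) {m δ r : ℝ}
    (hm : m ≤ Z.card * (1 - (1 - (p : ℝ)) ^ T.card)) (hδ : 0 ≤ δ) (hδ1 : δ ≤ 1)
    (hr : r ≤ (1 - δ) * m) :
    (SimpleGraph.binomialRandom V p).real {G | ((nbrsIn G T Z).card : ℝ) < r} ≤
      Real.exp (-(δ ^ 2 * m / 2)) := by
  have hτ := exp_neg_le_quadratic hδ
  have h1 := integral_pow_nbrsIn_le p h (Real.exp_pos (-δ)).le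
  have hq : 0 ≤ (Z.card : ℝ) * (1 - (1 - (p : ℝ)) ^ T.card) := by
    have : (1 - (p : ℝ)) ^ T.card ≤ 1 :=
      pow_le_one₀ (by linarith [p.2.2]) (by linarith [p.2.1])
    exact mul_nonneg (Nat.cast_nonneg _) (by linarith)
  have h2 := real_le_of_integral_le p (A := {G : SimpleGraph V | ((nbrsIn G T Z).card : ℝ) < r})
    (c := -δ * r) (fun G => by positivity) (fun G hG => by
      rw [← Real.exp_nat_mul, Real.exp_le_exp]
      have : ((nbrsIn G T Z).card : ℝ) < r := hG
      nlinarith) h1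
  refine h2.trans (Real.exp_le_exp.2 ?_)
  have h3 : (Z.card : ℝ) * (1 - (1 - (p : ℝ)) ^ T.card) * (Real.exp (-δ) - 1) ≤
      m * (-δ + δ ^ 2 / 2) :=
    calc _ ≤ (Z.card : ℝ) * (1 - (1 - (p : ℝ)) ^ T.card) * (-δ + δ ^ 2 / 2) :=
          mul_le_mul_of_nonneg_left (by linarith) hq
      _ ≤ _ := mul_le_mul_of_nonpos_right hm (by nlinarith)
  nlinarith

/-- Upper tail bound for the number of vertices of `Z` with a neighbour in `T`. -/
lemma real_lt_card_nbrsIn_le (p : unitInterval) {T Z : Finset V} (h : Disjoint T Z) {m δ r : ℝ}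
    (hm : Z.card * (1 - (1 - (p : ℝ)) ^ T.card) ≤ m) (hδ : 0 ≤ δ) (hδ1 : δ ≤ 1 / 10)
    (hr : (1 + δ) * m ≤ r) :
    (SimpleGraph.binomialRandom V p).real {G | r < ((nbrsIn G T Z).card : ℝ)} ≤
      Real.exp (-(9 / 20 * δ ^ 2 * m)) := by
  -- The cubic remainder is at most δ²/20 because δ ≤ 1/10. The final constant is 9/20 = 1 - 11/20.
  have hτ : Real.exp δ ≤ 1 + δ + 11 / 20 * δ ^ 2 := by
    have h1 := Real.exp_bound' hδ (by linarith) (n := 3) (by norm_num)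
    simp [Finset.sum_range_succ, Nat.factorial] at h1
    nlinarith [sq_nonneg δ]
  have h1 := integral_pow_nbrsIn_le p h (Real.exp_pos δ).le
  have hq : 0 ≤ (Z.card : ℝ) * (1 - (1 - (p : ℝ)) ^ T.card) := by
    have : (1 - (p : ℝ)) ^ T.card ≤ 1 :=
      pow_le_one₀ (by linarith [p.2.2]) (by linarith [p.2.1])
    exact mul_nonneg (Nat.cast_nonneg _) (by linarith)
  have h2 := real_le_of_integral_le p (A := {G : SimpleGraph V | r < ((nbrsIn G T Z).card : ℝ)})
    (c := δ * r) (fun G => by positivity) (fun G hG => by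
      rw [← Real.exp_nat_mul, Real.exp_le_exp]
      have : r < ((nbrsIn G T Z).card : ℝ) := hG
      nlinarith) h1
  refine h2.trans (Real.exp_le_exp.2 ?_)
  have h3 : (Z.card : ℝ) * (1 - (1 - (p : ℝ)) ^ T.card) * (Real.exp δ - 1) ≤
      m * (δ + 11 / 20 * δ ^ 2) :=
    calc _ ≤ (Z.card : ℝ) * (1 - (1 - (p : ℝ)) ^ T.card) * (δ + 11 / 20 * δ ^ 2) :=
          mul_le_mul_of_nonneg_left (by linarith) hq
      _ ≤ _ := mul_le_mul_of_nonneg_right hm (by positivity)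
  nlinarith [mul_le_mul_of_nonneg_left hr hδ]

end Neighbourhood

/-! ### Balls, spheres and fronts -/

section Exploration

variable {V : Type*}

lemma mem_nbrsIn {G : SimpleGraph V} {T Z : Finset V} {z : V} :
    z ∈ nbrsIn G T Z ↔ z ∈ Z ∧ ∃ t ∈ T, G.Adj t z := by
  classical
  simp [nbrsIn]

/-- The pairs with at least one end in `X`. -/
def touching (X : Finset V) : Set (Sym2 V) := {e | ∃ x ∈ X, x ∈ e}

lemma AgreeOn.adj_iff {X : Finset V} {G G' : SimpleGraph V} (h : AgreeOn (touching X) G G')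
    {x y : V} (hx : x ∈ X) : G.Adj x y ↔ G'.Adj x y :=
  h s(x, y) ⟨x, hx, by simp⟩

lemma nbrsIn_congr {X T : Finset V} (Z : Finset V) {G G' : SimpleGraph V}
    (h : AgreeOn (touching X) G G') (hT : T ⊆ X) : nbrsIn G T Z = nbrsIn G' T Z := by
  ext z
  simp only [mem_nbrsIn]
  refine and_congr_right fun _ => exists_congr fun t => and_congr_right fun ht => ?_
  exact h.adj_iff (hT ht)

variable [Fintype V]

open Classical in
/-- The vertices at distance less than `i` from `v`. -/
noncomputable def ballLT (G : SimpleGraph V) (v : V) : ℕ → Finset V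
  | 0 => ∅
  | i + 1 => insert v (nbrsIn G (ballLT G v i) Finset.univ)

lemma mem_ballLT_succ {G : SimpleGraph V} {v w : V} {i : ℕ} :
    w ∈ ballLT G v (i + 1) ↔ w = v ∨ ∃ t ∈ ballLT G v i, G.Adj t w := by
  classical
  simp [ballLT, mem_nbrsIn]

lemma self_mem_ballLT (G : SimpleGraph V) (v : V) (i : ℕ) : v ∈ ballLT G v (i + 1) :=
  mem_ballLT_succ.2 (Or.inl rfl)

lemma ballLT_mono (G : SimpleGraph V) (v : V) : Monotone (ballLT G v) := by
  refine monotone_nat_of_le_succ fun i => ?_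
  induction i with
  | zero => simp [ballLT]
  | succ i ih =>
    intro w hw
    rw [mem_ballLT_succ] at hw ⊢
    exact hw.imp_right fun ⟨t, ht, h⟩ => ⟨t, ih ht, h⟩

lemma mem_ballLT_of_walk {G : SimpleGraph V} {v w : V} (q : G.Walk w v) :
    w ∈ ballLT G v (q.length + 1) := by
  induction q with
  | nil => exact self_mem_ballLT _ _ _
  | cons h q ih => exact mem_ballLT_succ.2 (Or.inr ⟨_, ih, h.symm⟩)

lemma mem_ballLT {G : SimpleGraph V} {v w : V} {i : ℕ} :
    w ∈ ballLT G v i ↔ G.Reachable w v ∧ G.dist w v < i := by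
  constructor
  · intro h
    induction i generalizing w with
    | zero => simp [ballLT] at h
    | succ i ih =>
      rcases mem_ballLT_succ.1 h with rfl | ⟨t, ht, hadj⟩
      · exact ⟨SimpleGraph.Reachable.refl _, by simp⟩
      · obtain ⟨h1, h2⟩ := ih ht
        obtain ⟨q, hq⟩ := h1.exists_walk_length_eq_dist
        refine ⟨hadj.symm.reachable.trans h1, ?_⟩
        have := SimpleGraph.dist_le (SimpleGraph.Walk.cons hadj.symm q)
        simp only [SimpleGraph.Walk.length_cons] at this
        omega
  · rintro ⟨h1, h2⟩
    obtain ⟨q, hq⟩ := h1.exists_walk_length_eq_dist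
    exact ballLT_mono G v (by omega) (mem_ballLT_of_walk q)

/-- The edges touching a ball reveal one layer more than the ball itself, whence the bound `i + 1`
on `k`. -/
lemma ballLT_congr {X : Finset V} {G G' : SimpleGraph V} {v : V} {i : ℕ}
    (h : AgreeOn (touching X) G G') (hX : ballLT G v i ⊆ X) {k : ℕ} (hk : k ≤ i + 1) :
    ballLT G' v k = ballLT G v k := by
  classical
  induction k with
  | zero => rfl
  | succ k ih =>
    rw [ballLT, ballLT, ih (by omega), nbrsIn_congr _ h]
    exact (ballLT_mono G v (by omega)).trans hX

open Classical in
/-- The vertices at distance `i` from `v`. -/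
noncomputable def sphere (G : SimpleGraph V) (v : V) (i : ℕ) : Finset V :=
  ballLT G v (i + 1) \ ballLT G v i

lemma sphere_zero (G : SimpleGraph V) (v : V) : sphere G v 0 = {v} := by
  classical
  ext w
  simp [sphere, ballLT, mem_nbrsIn]

lemma nbrsIn_sphere [DecidableEq V] (G : SimpleGraph V) (v : V) (i : ℕ) :
    nbrsIn G (sphere G v i) (ballLT G v (i + 1))ᶜ = sphere G v (i + 1) := by
  classical
  ext w
  simp only [mem_nbrsIn, sphere, Finset.mem_sdiff, Finset.mem_compl]
  constructor
  · rintro ⟨h1, t, ⟨h2, _⟩, h3⟩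
    exact ⟨mem_ballLT_succ.2 (Or.inr ⟨t, h2, h3⟩), h1⟩
  · rintro ⟨h1, h2⟩
    rcases mem_ballLT_succ.1 h1 with rfl | ⟨t, ht, h⟩
    · exact absurd (self_mem_ballLT _ _ _) h2
    · exact ⟨h2, t, ⟨ht, fun h' => h2 (mem_ballLT_succ.2 (Or.inr ⟨t, h', h⟩))⟩, h⟩

lemma card_ballLT (G : SimpleGraph V) (v : V) (k : ℕ) :
    (ballLT G v k).card = ∑ i ∈ Finset.range k, (sphere G v i).card := by
  classical
  induction k with
  | zero => simp [ballLT]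
  | succ k ih =>
    have := Finset.card_sdiff_add_card_eq_card (ballLT_mono G v (Nat.le_succ k))
    rw [Finset.sum_range_succ, ← ih, sphere, ← this, add_comm]

open Classical in
/-- Vertices at distance `i` from `u` that are reached from `u` through vertices which stay at
least two steps further from `v` than from `u`. -/
noncomputable def front (G : SimpleGraph V) (u v : V) : ℕ → Finset V
  | 0 => {u}
  | i + 1 => nbrsIn G (front G u v i) (ballLT G u (i + 1) ∪ ballLT G v (i + 3))ᶜ

lemma front_subset (G : SimpleGraph V) (u v : V) (i : ℕ) :
    front G u v i ⊆ ballLT G u (i + 1) := by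
  classical
  induction i with
  | zero =>
    intro w hw
    rw [front, Finset.mem_singleton] at hw
    exact hw ▸ self_mem_ballLT _ _ _
  | succ i ih =>
    intro w hw
    rw [front, mem_nbrsIn] at hw
    obtain ⟨_, t, ht, h⟩ := hw
    exact mem_ballLT_succ.2 (Or.inr ⟨t, ih ht, h⟩)

lemma disjoint_front_left (G : SimpleGraph V) (u v : V) (i : ℕ) :
    Disjoint (front G u v i) (ballLT G u i) := by
  classical
  rw [Finset.disjoint_left]
  intro w hw h
  cases i with
  | zero => simp [ballLT] at h
  | succ i =>
    rw [front, mem_nbrsIn] at hw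
    simp [h] at hw

/-- Non-adjacency starts the induction: u itself is at distance at least 2 from v. Later layers
avoid the ball by construction. -/
lemma disjoint_front_right {G : SimpleGraph V} {u v : V} (hne : u ≠ v) (hadj : ¬ G.Adj u v)
    (i : ℕ) : Disjoint (front G u v i) (ballLT G v (i + 2)) := by
  classical
  rw [Finset.disjoint_left]
  intro w hw h
  cases i with
  | zero =>
    rw [front, Finset.mem_singleton] at hw
    subst hw
    rcases mem_ballLT_succ.1 h with h | ⟨t, ht, htw⟩
    · exact hne h
    · rcases mem_ballLT_succ.1 ht with rfl | ⟨t', ht', _⟩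
      · exact hadj htw.symm
      · simp [ballLT] at ht'
  | succ i =>
    rw [front, mem_nbrsIn] at hw
    simp [h] at hw

lemma front_congr {X : Finset V} {G G' : SimpleGraph V} {u v : V} {i : ℕ}
    (h : AgreeOn (touching X) G G') (hu : ballLT G u i ⊆ X) (hv : ballLT G v (i + 1) ⊆ X) {k : ℕ}
    (hk : k ≤ i) : front G' u v k = front G u v k := by
  classical
  induction k with
  | zero => rfl
  | succ k ih =>
    rw [front, front, ih (by omega), ballLT_congr h hu (by omega), ballLT_congr h hv (by omega),
      nbrsIn_congr _ h]
    exact (front_subset G u v k).trans ((ballLT_mono G u hk).trans hu)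

lemma isWitness_of_mem_front {G : SimpleGraph V} (hG : G.Connected) {u v : V} (hne : u ≠ v)
    (hadj : ¬ G.Adj u v) {i : ℕ} {w : V} (hw : w ∈ front G u v i) :
    G.dist w u = i ∧ i + 2 ≤ G.dist w v := by
  have h1 := (mem_ballLT.1 (front_subset G u v i hw)).2
  have h2 := Finset.disjoint_left.1 (disjoint_front_left G u v i) hw
  have h3 := Finset.disjoint_left.1 (disjoint_front_right hne hadj i) hw
  rw [mem_ballLT] at h2 h3
  have h4 := hG.preconnected w u
  have h5 := hG.preconnected w v
  simp only [h4, h5, true_and] at h2 h3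
  omega

/-- Vertices of one front are strictly closer to u, those of the other strictly closer to v, so the
two fronts cannot meet. -/
lemma card_front_add_le_ncard_witnesses {G : SimpleGraph V} (hG : G.Connected) {u v : V}
    (hne : u ≠ v) (hadj : ¬ G.Adj u v) (i : ℕ) :
    (front G u v i).card + (front G v u i).card ≤ (witnesses G u v).ncard := by
  classical
  have key1 : ∀ w ∈ front G u v i, _ := fun w hw => isWitness_of_mem_front hG hne hadj hw
  have key2 : ∀ w ∈ front G v u i, _ :=
    fun w hw => isWitness_of_mem_front hG hne.symm (fun h => hadj h.symm) hw
  rw [← Finset.card_union_of_disjoint, ← Set.ncard_coe_finset]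
  · refine Set.ncard_le_ncard ?_ (Set.toFinite _)
    intro w hw
    refine ⟨hG.preconnected w u, hG.preconnected w v, ?_⟩
    rcases Finset.mem_union.1 (Finset.mem_coe.1 hw) with h | h
    · obtain ⟨h1, h2⟩ := key1 w h
      rw [le_abs']
      left
      omega
    · obtain ⟨h1, h2⟩ := key2 w h
      rw [le_abs']
      right
      omega
  · rw [Finset.disjoint_left]
    intro w h1 h2
    have := key1 w h1
    have := key2 w h2
    omega

end Exploration

/-! ### One exploration step, and connectivity -/

section Steps

variable {V : Type*} [Fintype V]

/-- Conditionally on the edges touching an explored set `X`, the number of vertices of `Z` with a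
neighbour in `T` behaves as if `T` and `Z` were fixed. -/
lemma real_exposed_le (p : unitInterval) (F : SimpleGraph V → Finset V × Finset V × Finset V)
    (hF : ∀ G G', AgreeOn (touching (F G).1) G G' → F G' = F G)
    (K : Set (Finset V × Finset V × Finset V)) (R : Set ℕ) {β : ℝ} (hβ0 : 0 ≤ β)
    (hK : ∀ h ∈ K, Disjoint h.2.1 h.1 ∧ Disjoint h.2.2 h.1)
    (hβ : ∀ X T Z, (X, T, Z) ∈ K →
      (SimpleGraph.binomialRandom V p).real {G | (nbrsIn G T Z).card ∈ R} ≤ β) :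
    (SimpleGraph.binomialRandom V p).real
      {G | F G ∈ K ∧ (nbrsIn G (F G).2.1 (F G).2.2).card ∈ R} ≤ β := by
  refine real_history_le p F (fun h => {G | (nbrsIn G h.2.1 h.2.2).card ∈ R})
    (fun h => touching h.1) K hF ?_ (fun h _ hk => hβ h.1 h.2.1 h.2.2 hk) hβ0
  rintro ⟨X, T, Z⟩ _ hk G G' hG
  obtain ⟨h1, h2⟩ := hK _ hk
  simp only at h1 h2
  have : nbrsIn G T Z = nbrsIn G' T Z := by
    ext z
    simp only [mem_nbrsIn]
    refine and_congr_right fun hz => exists_congr fun t => and_congr_right fun ht => ?_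
    refine hG s(t, z) ?_
    rintro ⟨x, hx, hxe⟩
    rcases Sym2.mem_iff.1 hxe with rfl | rfl
    · exact Finset.disjoint_left.1 h1 ht hx
    · exact Finset.disjoint_left.1 h2 hz hx
  simp only [Set.mem_ofPred_eq, this]

lemma real_card_sphere_succ_le (p : unitInterval) (v : V) (i : ℕ) {s δ r : ℝ}
    (hδ : 0 ≤ δ) (hδ1 : δ ≤ 1 / 10) (hr : (1 + δ) * (Fintype.card V * p * s) ≤ r) :
    (SimpleGraph.binomialRandom V p).real
      {G | ((sphere G v i).card : ℝ) ≤ s ∧ r < ((sphere G v (i + 1)).card : ℝ)} ≤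
      Real.exp (-(9 / 20 * δ ^ 2 * (Fintype.card V * p * s))) := by
  classical
  have h := real_exposed_le p
    (fun G => (ballLT G v i, sphere G v i, (ballLT G v (i + 1))ᶜ))
    (fun G G' hG => by
      simp only [sphere, ballLT_congr hG subset_rfl le_rfl,
        ballLT_congr hG subset_rfl (Nat.le_succ i)])
    {h | (Disjoint h.2.1 h.1 ∧ Disjoint h.2.2 h.1) ∧ Disjoint h.2.1 h.2.2 ∧ (h.2.1.card : ℝ) ≤ s}
    {k | r < (k : ℝ)} (Real.exp_pos (-(9 / 20 * δ ^ 2 * (Fintype.card V * p * s)))).le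
    (fun h hh => hh.1)
    (by
      rintro X T Z ⟨_, hTZ, hT⟩
      refine real_lt_card_nbrsIn_le p hTZ ?_ hδ hδ1 hr
      simp only at hT
      have hp0 := p.2.1
      have hp1 := p.2.2
      have h1 := one_add_mul_le_pow (a := -(p : ℝ)) (by linarith) T.card
      have h2 : (Z.card : ℝ) ≤ Fintype.card V := by exact_mod_cast Finset.card_le_univ Z
      have h3 : (1 - (p : ℝ)) ^ T.card ≤ 1 := pow_le_one₀ (by linarith) (by linarith)
      rw [← sub_eq_add_neg] at h1
      calc _ ≤ (Fintype.card V : ℝ) * (p * s) := by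
            refine mul_le_mul h2 ?_ (by linarith) (Nat.cast_nonneg _)
            nlinarith
        _ = _ := by ring)
  refine le_trans (measureReal_mono ?_ (measure_ne_top _ _)) h
  rintro G ⟨h1, h2⟩
  refine ⟨⟨⟨?_, ?_⟩, ?_, h1⟩, ?_⟩
  · exact Finset.sdiff_disjoint
  · exact (disjoint_compl_left (a := ballLT G v (i + 1))).mono_right
      (ballLT_mono G v (Nat.le_succ i))
  · exact (disjoint_compl_right (a := ballLT G v (i + 1))).mono_left Finset.sdiff_subset
  · simpa [nbrsIn_sphere] using h2

/-- The exposed balls determine the current front and both next balls, but no edge from the front to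
the remaining vertices. At least `card V - b` vertices remain, each joined to the front with
probability at least 1 - exp(-pa). -/
lemma real_card_front_succ_lt (p : unitInterval) {u v : V} (hne : u ≠ v) (i : ℕ)
    {a b m δ r : ℝ} (hb : b ≤ Fintype.card V)
    (hm : m ≤ (Fintype.card V - b) * (1 - Real.exp (-(p * a))))
    (hδ : 0 ≤ δ) (hδ1 : δ ≤ 1) (hr : r ≤ (1 - δ) * m) :
    (SimpleGraph.binomialRandom V p).real
      {G | ¬ G.Adj u v ∧ a ≤ ((front G u v i).card : ℝ) ∧
        ((ballLT G u (i + 1)).card + (ballLT G v (i + 3)).card : ℝ) ≤ b ∧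
        ((front G u v (i + 1)).card : ℝ) < r} ≤ Real.exp (-(δ ^ 2 * m / 2)) := by
  classical
  have h := real_exposed_le p
    (fun G => (ballLT G u i ∪ ballLT G v (i + 2), front G u v i,
      (ballLT G u (i + 1) ∪ ballLT G v (i + 3))ᶜ))
    (fun G G' hG => by
      simp only [ballLT_congr hG Finset.subset_union_left le_rfl,
        ballLT_congr hG Finset.subset_union_left (Nat.le_succ i),
        ballLT_congr hG Finset.subset_union_right le_rfl,
        ballLT_congr hG Finset.subset_union_right (Nat.le_succ (i + 2)),
        front_congr hG Finset.subset_union_left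
          ((ballLT_mono G v (Nat.le_succ (i + 1))).trans Finset.subset_union_right) le_rfl])
    {h | (Disjoint h.2.1 h.1 ∧ Disjoint h.2.2 h.1) ∧ Disjoint h.2.1 h.2.2 ∧
      a ≤ (h.2.1.card : ℝ) ∧ (Fintype.card V : ℝ) - b ≤ (h.2.2.card : ℝ)}
    {k | (k : ℝ) < r} (Real.exp_pos (-(δ ^ 2 * m / 2))).le
    (fun h hh => hh.1)
    (by
      rintro X T Z ⟨_, hTZ, hT, hZ⟩
      refine real_card_nbrsIn_lt_le p hTZ (hm.trans ?_) hδ hδ1 hr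
      simp only at hT hZ
      have hp0 := p.2.1
      have hp1 := p.2.2
      have h3 : (1 - (p : ℝ)) ^ T.card ≤ 1 := pow_le_one₀ (by linarith) (by linarith)
      have h4 : (1 - (p : ℝ)) ^ T.card ≤ Real.exp (-(p * a)) := by
        calc (1 - (p : ℝ)) ^ T.card ≤ (Real.exp (-p)) ^ T.card :=
              pow_le_pow_left₀ (by linarith) (Real.one_sub_le_exp_neg p) _
          _ = Real.exp (-(p * T.card)) := by rw [← Real.exp_nat_mul]; ring_nf
          _ ≤ _ := Real.exp_le_exp.2 (by nlinarith)
      calc _ ≤ ((Fintype.card V : ℝ) - b) * (1 - (1 - (p : ℝ)) ^ T.card) :=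
            mul_le_mul_of_nonneg_left (by linarith) (by linarith)
        _ ≤ _ := mul_le_mul_of_nonneg_right hZ (by linarith))
  refine le_trans (measureReal_mono ?_ (measure_ne_top _ _)) h
  rintro G ⟨h1, h2, h3, h4⟩
  refine ⟨⟨⟨?_, ?_⟩, ?_, h2, ?_⟩, ?_⟩
  · exact Finset.disjoint_union_right.2
      ⟨disjoint_front_left G u v i, disjoint_front_right hne h1 i⟩
  · exact (disjoint_compl_left (a := ballLT G u (i + 1) ∪ ballLT G v (i + 3))).mono_right
      (Finset.union_subset_union (ballLT_mono G u (Nat.le_succ i))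
        (ballLT_mono G v (Nat.le_succ (i + 2))))
  · exact (disjoint_compl_right (a := ballLT G u (i + 1) ∪ ballLT G v (i + 3))).mono_left
      ((front_subset G u v i).trans Finset.subset_union_left)
  · have h5 := Finset.card_union_le (ballLT G u (i + 1)) (ballLT G v (i + 3))
    have h6 := Finset.card_add_card_compl (ballLT G u (i + 1) ∪ ballLT G v (i + 3))
    have h7 : ((ballLT G u (i + 1) ∪ ballLT G v (i + 3)).card : ℝ) ≤
        (ballLT G u (i + 1)).card + (ballLT G v (i + 3)).card := by exact_mod_cast h5
    have h8 : ((ballLT G u (i + 1) ∪ ballLT G v (i + 3)).card : ℝ) +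
        ((ballLT G u (i + 1) ∪ ballLT G v (i + 3))ᶜ.card : ℝ) = Fintype.card V := by
      exact_mod_cast h6
    simp only
    linarith
  · have : front G u v (i + 1) =
      nbrsIn G (front G u v i) (ballLT G u (i + 1) ∪ ballLT G v (i + 3))ᶜ := by
        rw [front]
    rw [this] at h4
    exact h4

/-- A vertex set without edges to its complement is unlikely. -/
lemma real_not_connected_le (p : unitInterval) [Nonempty V] :
    (SimpleGraph.binomialRandom V p).real {G | ¬ G.Connected} ≤
      (1 + Real.exp (-(p * Fintype.card V / 2))) ^ Fintype.card V - 1 := by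
  classical
  set μ := SimpleGraph.binomialRandom V p with hμ
  have hμp : IsProbabilityMeasure μ :=
    inferInstanceAs (IsProbabilityMeasure (SimpleGraph.binomialRandom V p))
  -- Only the smaller side of a cut is counted, so that its complement has at least half the
  -- vertices.
  let P : Finset (Finset V) := Finset.univ.filter fun S => S.Nonempty ∧ 2 * S.card ≤ Fintype.card V
  have h1 : {G : SimpleGraph V | ¬ G.Connected} ⊆ ⋃ S ∈ P, {G | (nbrsIn G S Sᶜ).card < (1 : ℝ)} := by
    intro G hG
    have hG' : ¬ G.Preconnected := fun h => hG ⟨h⟩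
    simp only [SimpleGraph.Preconnected, not_forall] at hG'
    obtain ⟨x, y, hxy⟩ := hG'
    let S : Finset V := Finset.univ.filter fun z => G.Reachable x z
    have hxS : x ∈ S := by simp [S]
    have hyS : y ∈ Sᶜ := by simpa [S] using hxy
    have hno : ∀ a ∈ S, ∀ b ∈ Sᶜ, ¬ G.Adj a b := by
      intro a ha b hb hab
      simp only [S, Finset.mem_compl, Finset.mem_filter, Finset.mem_univ, true_and] at ha hb
      exact hb (ha.trans hab.reachable)
    have hc := Finset.card_add_card_compl S
    have empty : ∀ A B : Finset V, (∀ a ∈ A, ∀ b ∈ B, ¬ G.Adj a b) →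
        ((nbrsIn G A B).card : ℝ) < 1 := by
      intro A B hAB
      have : nbrsIn G A B = ∅ := by
        refine Finset.eq_empty_of_forall_notMem fun z hz => ?_
        obtain ⟨hz, t, ht, h⟩ := mem_nbrsIn.1 hz
        exact hAB t ht z hz h
      simp [this]
    simp only [Set.mem_iUnion]
    by_cases hS : 2 * S.card ≤ Fintype.card V
    · exact ⟨S, by simpa [P] using ⟨⟨x, hxS⟩, hS⟩, empty _ _ hno⟩
    · refine ⟨Sᶜ, ?_, empty _ _ ?_⟩
      · simp only [P, Finset.mem_filter, Finset.mem_univ, true_and]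
        exact ⟨⟨y, hyS⟩, by omega⟩
      · intro a ha b hb hab
        rw [compl_compl] at hb
        exact hno b hb a ha hab.symm
  set x := Real.exp (-(p * Fintype.card V / 2)) with hx
  have h2 : ∀ S ∈ P, μ.real {G | ((nbrsIn G S Sᶜ).card : ℝ) < 1} ≤ x ^ S.card := by
    intro S hS
    have hS2 : 2 * S.card ≤ Fintype.card V := by
      simpa using (Finset.mem_filter.1 hS).2.2
    -- At τ = 0 the generating function is the probability of an empty neighbourhood, as 0^0 = 1.
    have h3 := integral_pow_nbrsIn p (disjoint_compl_right (a := S)) 0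
    have h4 := integral_ite_eq p {G : SimpleGraph V | ((nbrsIn G S Sᶜ).card : ℝ) < 1} 1 0
    have h5 : ∀ G : SimpleGraph V, (if G ∈ {G : SimpleGraph V |
        ((nbrsIn G S Sᶜ).card : ℝ) < 1} then (1 : ℝ) else 0) = 0 ^ (nbrsIn G S Sᶜ).card := by
      intro G
      rcases Nat.eq_zero_or_pos (nbrsIn G S Sᶜ).card with h | h
      · have h0 : ((nbrsIn G S Sᶜ).card : ℝ) < 1 := by
          rw [h]
          norm_num
        exact (if_pos h0).trans (by rw [h, pow_zero])
      · rw [if_neg, zero_pow h.ne']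
        simp only [Set.mem_ofPred_eq, not_lt]
        exact_mod_cast h
    simp_rw [h5] at h4
    rw [h3] at h4
    have h6 : μ.real {G | ((nbrsIn G S Sᶜ).card : ℝ) < 1} = ((1 - (p : ℝ)) ^ S.card) ^ Sᶜ.card := by
      rw [zero_add, sub_zero, mul_one] at h4
      rw [hμ, ← h4]
      ring
    have hp0 := p.2.1
    have hp1 := p.2.2
    have h7 : (Fintype.card V : ℝ) / 2 ≤ Sᶜ.card := by
      have h8 := Finset.card_add_card_compl S
      have h9 : (Fintype.card V : ℝ) ≤ 2 * Sᶜ.card := by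
        exact_mod_cast (by omega : Fintype.card V ≤ 2 * Sᶜ.card)
      linarith
    rw [h6, ← pow_mul, mul_comm, pow_mul]
    refine pow_le_pow_left₀ (pow_nonneg (by linarith) _) ?_ _
    calc (1 - (p : ℝ)) ^ Sᶜ.card ≤ (Real.exp (-p)) ^ Sᶜ.card :=
          pow_le_pow_left₀ (by linarith) (Real.one_sub_le_exp_neg p) _
      _ = Real.exp (-(p * Sᶜ.card)) := by rw [← Real.exp_nat_mul]; ring_nf
      _ ≤ _ := Real.exp_le_exp.2 (by nlinarith)
  calc μ.real {G | ¬ G.Connected}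
      ≤ μ.real (⋃ S ∈ P, {G | ((nbrsIn G S Sᶜ).card : ℝ) < 1}) :=
        measureReal_mono h1 (measure_ne_top _ _)
    _ ≤ ∑ S ∈ P, μ.real {G | ((nbrsIn G S Sᶜ).card : ℝ) < 1} := measureReal_biUnion_finset_le _ _
    _ ≤ ∑ S ∈ P, x ^ S.card := Finset.sum_le_sum h2
    -- Dropping the size restriction turns the sum into a binomial expansion without its constant
    -- term.
    _ ≤ ∑ S ∈ (Finset.univ : Finset (Finset V)).erase ∅, x ^ S.card := by
        refine Finset.sum_le_sum_of_subset_of_nonneg ?_ fun _ _ _ => by positivity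
        intro S hS
        exact Finset.mem_erase.2 ⟨(Finset.mem_filter.1 hS).2.1.ne_empty, Finset.mem_univ _⟩
    _ = (1 + x) ^ Fintype.card V - 1 := by
        have := Fintype.sum_pow_mul_eq_add_pow V x 1
        simp only [one_pow, mul_one] at this
        rw [add_comm 1 x, ← this, ← Finset.add_sum_erase _ _ (Finset.mem_univ ∅)]
        simp

end Steps

/-! ### Growth of spheres and fronts -/

section Growth

/-- Upper bound for the size of a sphere of radius `i` when the mean degree is `D`. -/
noncomputable def sphereBound (D : ℝ) (i : ℕ) : ℝ := (5 / 4 - (1 / 2) ^ i / 4) * D ^ i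

/-- Lower bound for the size of the `i`-th front when the mean degree is `D`. -/
noncomputable def frontBound (n D : ℝ) (i : ℕ) : ℝ :=
  (4 / 5 + (1 / 2) ^ i / 5 - 8 / 5 * (D ^ (i + 1) / n)) * D ^ i

lemma half_pow_pos (i : ℕ) : 0 < ((1 : ℝ) / 2) ^ i := by positivity

lemma half_pow_le_one (i : ℕ) : ((1 : ℝ) / 2) ^ i ≤ 1 := pow_le_one₀ (by norm_num) (by norm_num)

lemma half_pow_sq_mul_pow (D : ℝ) (i : ℕ) : (((1 : ℝ) / 2) ^ i) ^ 2 * D ^ i = (D / 4) ^ i := by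
  rw [← pow_mul, mul_comm i 2, pow_mul, ← mul_pow]
  congr 1
  ring

lemma sum_pow_le {D : ℝ} (hD : 2000 ≤ D) (k : ℕ) :
    ∑ i ∈ Finset.range (k + 1), D ^ i ≤ 1001 / 1000 * D ^ k := by
  induction k with
  | zero => norm_num
  | succ k ih =>
    rw [Finset.sum_range_succ, pow_succ]
    have : 0 < D ^ k := by positivity
    nlinarith

variable {V : Type*} [Fintype V]

lemma card_ballLT_succ_le {D : ℝ} (hD : 2000 ≤ D) {G : SimpleGraph V} {v : V} {k : ℕ}
    (h : ∀ i ≤ k, ((sphere G v i).card : ℝ) ≤ sphereBound D i) :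
    ((ballLT G v (k + 1)).card : ℝ) ≤ 63 / 50 * D ^ k := by
  rw [card_ballLT]
  push_cast
  have h1 : ∀ i ∈ Finset.range (k + 1), ((sphere G v i).card : ℝ) ≤ 5 / 4 * D ^ i := by
    intro i hi
    refine (h i (by simpa [Nat.lt_succ_iff] using hi)).trans ?_
    have := half_pow_pos i
    exact mul_le_mul_of_nonneg_right (by linarith) (by positivity)
  have h2 := Finset.sum_le_sum h1
  rw [← Finset.mul_sum] at h2
  have h3 := sum_pow_le hD k
  have : 0 < D ^ k := by positivity
  linarith

/-- The sphere around `v` grows too fast at radius `i`. -/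
def wideSphere (D : ℝ) (v : V) (i : ℕ) : Set (SimpleGraph V) :=
  {G | ((sphere G v i).card : ℝ) ≤ sphereBound D i ∧
    sphereBound D (i + 1) < ((sphere G v (i + 1)).card : ℝ)}

/-- The front of the non-adjacent pair `u`, `v` grows too slowly at distance `i`. -/
def thinFront (D : ℝ) (u v : V) (i : ℕ) : Set (SimpleGraph V) :=
  {G | ¬ G.Adj u v ∧ frontBound (Fintype.card V) D i ≤ ((front G u v i).card : ℝ) ∧
    ((ballLT G u (i + 1)).card + (ballLT G v (i + 3)).card : ℝ) ≤ 13 / 10 * D ^ (i + 2) ∧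
    ((front G u v (i + 1)).card : ℝ) < frontBound (Fintype.card V) D (i + 1)}

lemma card_sphere_le {D : ℝ} {G : SimpleGraph V} {v : V} {n : ℕ}
    (h : ∀ i < n, G ∉ wideSphere D v i) {i : ℕ} (hi : i ≤ n) :
    ((sphere G v i).card : ℝ) ≤ sphereBound D i := by
  induction i with
  | zero => norm_num [sphere_zero, sphereBound]
  | succ i ih =>
    by_contra hc
    exact h i (by omega) ⟨ih (by omega), not_le.1 hc⟩

/-- With e = 2^(-i), passing from 5/4 - e/4 to 5/4 - e/8 leaves room for a relative deviation e/10.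
Since e²D^i = (D/4)^i ≥ 1, the Chernoff exponent is at least 9D/2000 ≥ 9L. -/
lemma real_wideSphere_le (p : unitInterval) {D L : ℝ} (hDp : D = Fintype.card V * p)
    (hL : 1 ≤ L) (hD : 2000 * L ≤ D) (v : V) (i : ℕ) :
    (SimpleGraph.binomialRandom V p).real (wideSphere D v i) ≤ Real.exp (-(8 * L)) := by
  set e : ℝ := (1 / 2) ^ i with he
  have he0 : 0 < e := half_pow_pos i
  have he1 : e ≤ 1 := half_pow_le_one i
  have hP : 0 < D ^ i := pow_pos (by linarith) i
  have hs : D ^ i ≤ sphereBound D i := by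
    rw [sphereBound, ← he]
    nlinarith
  refine (real_card_sphere_succ_le p v i (δ := e / 10) (by positivity) (by linarith)
    (r := sphereBound D (i + 1)) ?_).trans (Real.exp_le_exp.2 ?_)
  · rw [← hDp, sphereBound, sphereBound, pow_succ, pow_succ, ← he]
    have h1 : (1 + e / 10) * (5 / 4 - e / 4) ≤ 5 / 4 - e * (1 / 2) / 4 := by nlinarith
    have h2 : 0 ≤ D ^ i * D := mul_nonneg hP.le (by linarith)
    calc _ = (1 + e / 10) * (5 / 4 - e / 4) * (D ^ i * D) := by ring
      _ ≤ _ := mul_le_mul_of_nonneg_right h1 h2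
  · rw [← hDp]
    have h1 : 1 ≤ e ^ 2 * D ^ i := by
      rw [he, half_pow_sq_mul_pow]
      exact one_le_pow₀ (by linarith)
    have h2 : 1 ≤ e ^ 2 * sphereBound D i :=
      h1.trans (mul_le_mul_of_nonneg_left hs (by positivity))
    have h3 : D ≤ D * (e ^ 2 * sphereBound D i) := le_mul_of_one_le_right (by linarith) h2
    nlinarith

/-- With x = D^(i+2)/n, excluding the balls costs a factor 1 - 13x/10. Several front vertices
sharing a neighbour costs 1 - y/2 with y ≤ x/2000; together the factor is at least 1 - 7x/5. The
change of correction from 8w/5 to 8x/5 pays for this, and the halving of e/5 pays for the deviation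
e/10. -/
lemma real_thinFront_le (p : unitInterval) {D L : ℝ} (hDp : D = Fintype.card V * p)
    (hL : 1 ≤ L) (hD : 2000 * L ≤ D) (hD2 : D ^ 2 ≤ Fintype.card V / 100) {u v : V} (hne : u ≠ v)
    {i : ℕ} (hi : D ^ (i + 2) ≤ 2 / 5 * Fintype.card V) :
    (SimpleGraph.binomialRandom V p).real (thinFront D u v i) ≤ Real.exp (-(8 * L)) := by
  have hD0 : 0 < D := by linarith
  have hn : 0 < (Fintype.card V : ℝ) := by nlinarith
  set n : ℝ := ((Fintype.card V : ℕ) : ℝ)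
  set e : ℝ := (1 / 2) ^ i with he
  have he0 : 0 < e := half_pow_pos i
  have he1 : e ≤ 1 := half_pow_le_one i
  have hP : 0 < D ^ i := pow_pos (by linarith) i
  set w : ℝ := D ^ (i + 1) / n with hw
  set x : ℝ := D ^ (i + 2) / n with hx
  have hxw : x = D * w := by
    rw [hx, hw]
    ring
  have hx1 : x ≤ 2 / 5 := by
    rw [hx, div_le_iff₀ hn]
    exact hi
  have hw0 : 0 < w := div_pos (pow_pos (by linarith) _) hn
  have hwx : 2000 * w ≤ x := by nlinarith
  set c : ℝ := 4 / 5 + e / 5 - 8 / 5 * w with hc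
  have hc1 : c ≤ 1 := by linarith
  have hc0 : 79 / 100 ≤ c := by linarith
  have hfb : frontBound n D i = c * D ^ i := by rw [frontBound]
  have hfb' : frontBound n D (i + 1) = (4 / 5 + e / 10 - 8 / 5 * x) * (D * D ^ i) := by
    rw [frontBound, pow_succ, ← he, ← hx]
    ring
  refine (real_card_front_succ_lt p hne i (a := frontBound n D i) (b := 13 / 10 * D ^ (i + 2))
    (m := D * (c * D ^ i) * (1 - 7 / 5 * x)) (δ := e / 10) (r := frontBound n D (i + 1))
    ?_ ?_ (by positivity) (by linarith) ?_).trans (Real.exp_le_exp.2 ?_)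
  · linarith
  · set y : ℝ := p * frontBound n D i with hy
    have hny : n * y = D * (c * D ^ i) := by
      rw [hy, hfb, hDp]
      ring
    have hy0 : 0 ≤ y := mul_nonneg p.2.1 (hfb ▸ mul_nonneg (by linarith) hP.le)
    have hyw : y ≤ w := by
      rw [hw, le_div_iff₀ hn, mul_comm, hny, pow_succ]
      have : 0 ≤ D ^ i * D := mul_nonneg hP.le (by linarith)
      nlinarith
    have h1 := exp_neg_le_quadratic hy0
    have h2 : D ^ (i + 2) = x * n := by
      rw [hx]
      field_simp
    have h3 : y * (1 - y / 2) ≤ 1 - Real.exp (-y) := by linarith [sq y]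
    have h4 : 0 ≤ n - 13 / 10 * D ^ (i + 2) := by linarith
    refine le_trans ?_ (mul_le_mul_of_nonneg_left h3 h4)
    rw [h2, ← hny]
    have h5 : 1 - 7 / 5 * x ≤ (1 - 13 / 10 * x) * (1 - y / 2) := by nlinarith
    calc n * y * (1 - 7 / 5 * x) ≤ n * y * ((1 - 13 / 10 * x) * (1 - y / 2)) :=
          mul_le_mul_of_nonneg_left h5 (by positivity)
      _ = _ := by ring
  · rw [hfb']
    have h1 : 4 / 5 + e / 10 - 8 / 5 * x ≤ (1 - e / 10) * (c * (1 - 7 / 5 * x)) := by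
      have h2 : c - 7 / 5 * x ≤ c * (1 - 7 / 5 * x) := by nlinarith
      have h3 : c * (1 - 7 / 5 * x) ≤ 1 := by nlinarith
      nlinarith
    calc _ ≤ (1 - e / 10) * (c * (1 - 7 / 5 * x)) * (D * D ^ i) :=
          mul_le_mul_of_nonneg_right h1 (mul_nonneg (by linarith) hP.le)
      _ = _ := by ring
  -- For i = 0 no power of D helps, and x ≤ 1/100 comes from D² ≤ n/100. For i ≥ 1 the factor
  -- (D/4)^i ≥ 500 outweighs the weak bound 1 - 7x/5 ≥ 11/25. The value 4/5 makes the exponent D/250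
  -- ≥ 8L.
  · have h1 : 4 / 5 ≤ e ^ 2 * D ^ i * (c * (1 - 7 / 5 * x)) := by
      rw [he, half_pow_sq_mul_pow]
      rcases Nat.eq_zero_or_pos i with h0 | h0
      · have hx2 : x ≤ 1 / 100 := by
          rw [hx, h0, zero_add, div_le_iff₀ hn]
          linarith
        have he2 : e = 1 := by rw [he, h0, pow_zero]
        rw [h0, pow_zero]
        nlinarith
      · have h2 : D / 4 ≤ (D / 4) ^ i := le_self_pow₀ (by linarith) h0.ne'
        have h3 : 79 / 100 * (11 / 25) ≤ c * (1 - 7 / 5 * x) :=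
          mul_le_mul hc0 (by linarith) (by norm_num) (by linarith)
        have h4 : 500 ≤ (D / 4) ^ i := by linarith
        calc (4 / 5 : ℝ) ≤ 500 * (79 / 100 * (11 / 25)) := by norm_num
          _ ≤ _ := mul_le_mul h4 h3 (by norm_num) (by linarith)
    have h2 : D * (4 / 5) ≤ D * (e ^ 2 * D ^ i * (c * (1 - 7 / 5 * x))) :=
      mul_le_mul_of_nonneg_left h1 hD0.le
    have h3 : (e / 10) ^ 2 * (D * (c * D ^ i) * (1 - 7 / 5 * x)) / 2 =
      D * (e ^ 2 * D ^ i * (c * (1 - 7 / 5 * x))) / 200 := by ring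
    rw [h3]
    linarith

lemma le_card_front {D : ℝ} (hD : 2000 ≤ D) {G : SimpleGraph V}
    (hs : ∀ v, ∀ i ≤ Fintype.card V, ((sphere G v i).card : ℝ) ≤ sphereBound D i)
    {u v : V} (hadj : ¬ G.Adj u v)
    (hf : ∀ i < Fintype.card V, D ^ (i + 2) ≤ 2 / 5 * Fintype.card V → G ∉ thinFront D u v i)
    {j : ℕ} (hj : D ^ (j + 1) ≤ 2 / 5 * Fintype.card V) (hjn : j + 1 ≤ Fintype.card V) :
    frontBound (Fintype.card V) D j ≤ ((front G u v j).card : ℝ) := by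
  induction j with
  | zero =>
    have : 0 ≤ D ^ (0 + 1) / (Fintype.card V : ℝ) := by positivity
    simp only [frontBound, front, Finset.card_singleton, Nat.cast_one, pow_zero, mul_one]
    linarith
  | succ j ih =>
    have hpow : D ^ (j + 1) ≤ D ^ (j + 1 + 1) := pow_le_pow_right₀ (by linarith) (Nat.le_succ _)
    by_contra hc
    -- The first front that is too small would witness `thinFront`; the open goal is the bound on
    -- the two balls, which follows from the sphere bounds.
    refine hf j (by omega) hj ⟨hadj, ih (hpow.trans hj) (by omega), ?_, not_le.1 hc⟩
    have h1 := card_ballLT_succ_le hD (k := j) fun i hi => hs u i (by omega)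
    have h2 := card_ballLT_succ_le hD (k := j + 2) fun i hi => hs v i (by omega)
    have h3 : 0 < D ^ j := by positivity
    have h4 : D ^ (j + 2) = D ^ j * D ^ 2 := pow_add _ _ _
    have h5 : D ^ j * 2000 ^ 2 ≤ D ^ j * D ^ 2 :=
      mul_le_mul_of_nonneg_left (pow_le_pow_left₀ (by norm_num) hD 2) h3.le
    rw [h4] at h2 ⊢
    linarith

end Growth

/-! ### Regular graphs and the count of well-witnessed pairs -/

section Conclusion

/-- The properties of the random graph from which the theorem is deduced. -/
structure Regular {V : Type*} [Fintype V] (D : ℝ) (G : SimpleGraph V) : Prop where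
  connected : G.Connected
  sphere_le : ∀ v, ∀ i ≤ Fintype.card V, ((sphere G v i).card : ℝ) ≤ sphereBound D i
  not_thinFront : ∀ u v, u ≠ v → ∀ i < Fintype.card V,
    D ^ (i + 2) ≤ 2 / 5 * Fintype.card V → G ∉ thinFront D u v i

/-- Union bound: disconnection costs 2nβ, the n² pairs (v, i) cost n²β, and the at most n³ triples
(u, v, i) cost n³β. -/
lemma real_not_regular_le {V : Type*} [Fintype V] [Nonempty V] (p : unitInterval) {D L : ℝ}
    (hDp : D = Fintype.card V * p) (hL : 1 ≤ L) (hD : 2000 * L ≤ D)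
    (hD2 : D ^ 2 ≤ Fintype.card V / 100) (hn : (Fintype.card V : ℝ) ≤ Real.exp L) :
    (SimpleGraph.binomialRandom V p).real {G | ¬ Regular D G} ≤
      4 * (Fintype.card V : ℝ) ^ 3 * Real.exp (-(8 * L)) := by
  classical
  set n := Fintype.card V with hn_def
  have hn1 : (1 : ℝ) ≤ n := by exact_mod_cast Fintype.card_pos
  set μ := SimpleGraph.binomialRandom V p with hμ
  have hμp : IsProbabilityMeasure μ :=
    inferInstanceAs (IsProbabilityMeasure (SimpleGraph.binomialRandom V p))
  set β := Real.exp (-(8 * L)) with hβ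
  let A : Set (SimpleGraph V) := {G | ¬ G.Connected}
  let B : Set (SimpleGraph V) := ⋃ q ∈ (Finset.univ : Finset V) ×ˢ Finset.range n,
    wideSphere D q.1 q.2
  let Q : Finset ((V × V) × ℕ) :=
    ((Finset.univ : Finset (V × V)) ×ˢ Finset.range n).filter
      fun q => q.1.1 ≠ q.1.2 ∧ D ^ (q.2 + 2) ≤ 2 / 5 * (n : ℝ)
  let C : Set (SimpleGraph V) := ⋃ q ∈ Q, thinFront D q.1.1 q.1.2 q.2
  have hsub : {G | ¬ Regular D G} ⊆ A ∪ B ∪ C := by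
    intro G hG
    by_contra hc
    simp only [Set.mem_union, not_or] at hc
    obtain ⟨⟨hA, hB⟩, hC⟩ := hc
    simp only [B, C, Set.mem_iUnion, not_exists] at hB hC
    refine hG ⟨not_not.1 hA, fun v i hi => card_sphere_le (fun k hk => ?_) hi, ?_⟩
    · exact hB (v, k) (by simpa using hk)
    · intro u v hne i hi hDi
      exact hC ((u, v), i) (by simpa [Q] using ⟨hi, hne, hDi⟩)
  have hA : μ.real A ≤ 2 * n * β := by
    refine (real_not_connected_le p).trans ?_
    set x := Real.exp (-(p * Fintype.card V / 2)) with hx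
    have hx1 : x ≤ β := by
      rw [hx, hβ, Real.exp_le_exp, mul_comm, ← hn_def, ← hDp]
      linarith
    have hnx : n * x ≤ 1 := by
      calc n * x ≤ Real.exp L * β :=
            mul_le_mul hn hx1 (Real.exp_pos _).le (Real.exp_pos _).le
        _ = Real.exp (L + -(8 * L)) := (Real.exp_add _ _).symm
        _ ≤ 1 := Real.exp_le_one_iff.2 (by linarith)
    have hx0 : 0 < x := Real.exp_pos _
    have h1 : (1 + x) ^ n ≤ Real.exp (n * x) := by
      rw [Real.exp_nat_mul]
      exact pow_le_pow_left₀ (by linarith) (by linarith [Real.add_one_le_exp x]) _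
    have h2 := Real.abs_exp_sub_one_le (x := n * x) (by rwa [abs_of_nonneg (by positivity)])
    rw [abs_of_nonneg (a := n * x) (by positivity)] at h2
    have h3 := le_abs_self (Real.exp (n * x) - 1)
    have h4 : n * x ≤ n * β := mul_le_mul_of_nonneg_left hx1 (by linarith)
    linarith
  have hB : μ.real B ≤ n ^ 2 * β := by
    refine (measureReal_biUnion_finset_le _ _).trans ?_
    refine (Finset.sum_le_sum fun q _ => real_wideSphere_le p hDp hL hD q.1 q.2).trans ?_
    simp only [Finset.sum_const, Finset.card_product, Finset.card_univ, Finset.card_range,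
      nsmul_eq_mul, Nat.cast_mul]
    exact le_of_eq (by ring)
  have hC : μ.real C ≤ n ^ 3 * β := by
    refine (measureReal_biUnion_finset_le _ _).trans ?_
    refine (Finset.sum_le_sum fun q hq => real_thinFront_le p hDp hL hD hD2
      (Finset.mem_filter.1 hq).2.1 (Finset.mem_filter.1 hq).2.2).trans ?_
    rw [Finset.sum_const, nsmul_eq_mul]
    refine mul_le_mul_of_nonneg_right ?_ (Real.exp_pos _).le
    have : Q.card ≤ n ^ 3 := by
      refine (Finset.card_filter_le _ _).trans (le_of_eq ?_)
      simp only [Finset.card_product, Finset.card_univ, Fintype.card_prod, Finset.card_range]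
      ring
    exact_mod_cast this
  have hβ0 : 0 < β := Real.exp_pos _
  have h1 : μ.real {G | ¬ Regular D G} ≤ μ.real A + μ.real B + μ.real C :=
    (measureReal_mono hsub (measure_ne_top _ _)).trans
      ((measureReal_union_le _ _).trans (add_le_add_left (measureReal_union_le _ _) _))
  have h2 : (n : ℝ) * β ≤ n ^ 2 * β :=
    mul_le_mul_of_nonneg_right (by nlinarith) hβ0.le
  have h3 : (n : ℝ) ^ 2 * β ≤ n ^ 3 * β :=
    mul_le_mul_of_nonneg_right (pow_le_pow_right₀ hn1 (by norm_num)) hβ0.le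
  linarith

lemma exists_radius {n D : ℝ} (hD : 2000 ≤ D) (hD2 : D ^ 2 ≤ n / 100) :
    ∃ j : ℕ, D ^ (j + 1) ≤ 2 / 5 * n ∧ 2 / 5 * n < D ^ (j + 2) := by
  classical
  have hex : ∃ k : ℕ, 2 / 5 * n < D ^ (k + 2) := by
    obtain ⟨k, hk⟩ := pow_unbounded_of_one_lt (2 / 5 * n) (by linarith : 1 < D)
    exact ⟨k, hk.trans_le (pow_le_pow_right₀ (by linarith) (by omega))⟩
  refine ⟨Nat.find hex, ?_, Nat.find_spec hex⟩
  rcases Nat.eq_zero_or_pos (Nat.find hex) with h | h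
  · rw [h, zero_add, pow_one]
    nlinarith
  · have := Nat.find_min hex (Nat.sub_lt h one_pos)
    rw [not_lt] at this
    rwa [show Nat.find hex - 1 + 2 = Nat.find hex + 1 by omega] at this

/-- Put y = D^(j+1)/n ≤ 2/5. If y is small, the coefficient is near 4/5 and D^(j+2) > 2n/5 suffices.
Otherwise the coefficient may drop to 4/25, but D^(j+2) = yDn ≥ 20n. -/
lemma le_frontBound {n D : ℝ} (hn : 0 < n) (hD : 2000 ≤ D) {j : ℕ}
    (h1 : D ^ (j + 1) ≤ 2 / 5 * n) (h2 : 2 / 5 * n < D ^ (j + 2)) :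
    13 / 50 * (n / D ^ 2) ≤ frontBound n D j := by
  rw [frontBound, ← mul_div_assoc, div_le_iff₀ (by positivity)]
  set y := D ^ (j + 1) / n with hy
  have hy1 : y ≤ 2 / 5 := by
    rw [hy, div_le_iff₀ hn]
    exact h1
  have hDj : D ^ j * D ^ 2 = D ^ (j + 2) := (pow_add _ _ _).symm
  have hyD : D ^ (j + 2) = y * D * n := by
    rw [hy]
    field_simp
    ring
  have he := half_pow_pos j
  rw [mul_assoc, hDj]
  have hpos : 0 < D ^ (j + 2) := by positivity
  have h3 : (4 / 5 - 8 / 5 * y) * D ^ (j + 2) ≤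
      (4 / 5 + (1 / 2) ^ j / 5 - 8 / 5 * y) * D ^ (j + 2) :=
    mul_le_mul_of_nonneg_right (by linarith) hpos.le
  refine le_trans ?_ h3
  rcases le_total y (1 / 100) with h | h
  · have : (784 / 1000) * D ^ (j + 2) ≤ (4 / 5 - 8 / 5 * y) * D ^ (j + 2) :=
      mul_le_mul_of_nonneg_right (by linarith) hpos.le
    linarith
  · have h4 : (4 / 25) * D ^ (j + 2) ≤ (4 / 5 - 8 / 5 * y) * D ^ (j + 2) :=
      mul_le_mul_of_nonneg_right (by linarith) hpos.le
    have h5 : 20 * n ≤ y * D * n := mul_le_mul_of_nonneg_right (by nlinarith) hn.le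
    linarith

lemma Regular.le_ncard_witnesses {V : Type*} [Fintype V] {D : ℝ} {G : SimpleGraph V}
    (hG : Regular D G) (hD : 2000 ≤ D) (hD2 : D ^ 2 ≤ Fintype.card V / 100) {u v : V}
    (hne : u ≠ v) (hadj : ¬ G.Adj u v) :
    13 / 25 * (Fintype.card V / D ^ 2) ≤ ((witnesses G u v).ncard : ℝ) := by
  have hn : 0 < (Fintype.card V : ℝ) := by nlinarith
  obtain ⟨j, hj1, hj2⟩ := exists_radius hD hD2
  -- `Regular` controls radii only up to the number of vertices; j is logarithmic in it.
  have hjn : j + 1 ≤ Fintype.card V := by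
    have h1 : (2 : ℝ) ^ (j + 1) ≤ D ^ (j + 1) := pow_le_pow_left₀ (by norm_num) (by linarith) _
    have h2 : (2 : ℝ) ^ (j + 1) ≤ Fintype.card V := by linarith
    have h3 : 2 ^ (j + 1) ≤ Fintype.card V := by exact_mod_cast h2
    exact (Nat.lt_two_pow_self).le.trans h3
  have h1 := le_card_front hD hG.sphere_le hadj (hG.not_thinFront u v hne) hj1 hjn
  have h2 := le_card_front hD hG.sphere_le (fun h => hadj h.symm) (hG.not_thinFront v u hne.symm)
    hj1 hjn
  have h3 := le_frontBound hn hD hj1 hj2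
  have h4 : ((front G u v j).card : ℝ) + (front G v u j).card ≤ (witnesses G u v).ncard := by
    exact_mod_cast card_front_add_le_ncard_witnesses hG.connected hne hadj j
  linarith

lemma ncard_edgeSet_le {V : Type*} [Fintype V] {G : SimpleGraph V} {b : ℝ}
    (h : ∀ v, ((sphere G v 1).card : ℝ) ≤ b) :
    (G.edgeSet.ncard : ℝ) ≤ Fintype.card V * b := by
  classical
  have h1 : ∀ v, G.degree v ≤ (sphere G v 1).card := by
    intro v
    refine Finset.card_le_card fun w hw => ?_
    rw [SimpleGraph.mem_neighborFinset] at hw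
    rw [sphere, Finset.mem_sdiff, mem_ballLT, mem_ballLT, SimpleGraph.dist_comm,
      SimpleGraph.dist_eq_one_iff_adj.2 hw]
    exact ⟨⟨hw.symm.reachable, by norm_num⟩, by simp⟩
  have h2 := G.sum_degrees_eq_twice_card_edges
  have h3 : (∑ v, (G.degree v : ℝ)) ≤ ∑ _v : V, b :=
    Finset.sum_le_sum fun v _ => le_trans (by exact_mod_cast h1 v) (h v)
  rw [Finset.sum_const, nsmul_eq_mul, Finset.card_univ] at h3
  have h4 : (∑ v, (G.degree v : ℝ)) = 2 * G.edgeFinset.card := by exact_mod_cast h2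
  have h5 : G.edgeSet.ncard = G.edgeFinset.card := by
    rw [← Set.ncard_coe_finset, SimpleGraph.coe_edgeFinset]
  rw [h5]
  have : (0 : ℝ) ≤ G.edgeFinset.card := Nat.cast_nonneg _
  linarith

lemma choose_le_ncard_wellWitnessed_add {V : Type*} [Fintype V] {G : SimpleGraph V} {t : ℝ}
    (h : ∀ u v, u ≠ v → ¬ G.Adj u v → t ≤ ((witnesses G u v).ncard : ℝ)) :
    (Fintype.card V).choose 2 ≤ (wellWitnessed G t).ncard + G.edgeSet.ncard := by
  classical
  have h1 : (Sym2.diagSetᶜ : Set (Sym2 V)).ncard = (Fintype.card V).choose 2 := by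
    rw [← Sym2.card_diagSet_compl, Set.ncard_eq_toFinset_card', Set.toFinset_card]
  rw [← h1]
  refine (Set.ncard_le_ncard ?_ (Set.toFinite _)).trans (Set.ncard_union_le _ _)
  intro e
  induction e with
  | _ u v =>
    intro he
    have hne : u ≠ v := by simpa using he
    by_cases hadj : G.Adj u v
    · exact Or.inr hadj
    · exact Or.inl ⟨u, v, rfl, hne, hadj, h u v hne hadj⟩

end Conclusion

end RandomGraphWitness

/-! ### Sparse and dense ranges, and the choice of constants -/

open RandomGraphWitness MeasureTheory in
lemma one_sub_le_real_wellWitnessed {n : ℕ} (hn : 1000 ≤ n) (p : unitInterval)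
    (hp : 2000 * Real.log n / n ≤ (p : ℝ)) :
    1 - ((n : ℝ) ^ 2)⁻¹ ≤ (SimpleGraph.binomialRandom (Fin n) p).real
      {G : SimpleGraph (Fin n) |
        (n.choose 2 : ℝ) - 400 * (n * expDeg n p ^ 2) ≤
          ((wellWitnessed G ((1 / 2 - 0) * (n / expDeg n p ^ 2))).ncard : ℝ)} := by
  have hn0 : (1000 : ℝ) ≤ n := by exact_mod_cast hn
  have hnpos : (0 : ℝ) < n := by linarith
  have : Nonempty (Fin n) := ⟨⟨0, by omega⟩⟩
  set D : ℝ := n * p with hD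
  have hdeg : expDeg n p = D * (1 - 1 / n) := by
    rw [expDeg, hD]
    field_simp
  have hinv : 1 / (n : ℝ) ≤ 1 / 1000 := one_div_le_one_div_of_le (by norm_num) hn0
  have hinv0 : 0 < 1 / (n : ℝ) := by positivity
  have hL : 1 ≤ Real.log n := by
    rw [Real.le_log_iff_exp_le hnpos]
    linarith [Real.exp_one_lt_d9]
  have hDL : 2000 * Real.log n ≤ D := by
    rw [div_le_iff₀ hnpos] at hp
    rw [hD]
    linarith
  have hD0 : 2000 ≤ D := by linarith
  have hsq : 99 / 100 * D ^ 2 ≤ expDeg n p ^ 2 := by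
    rw [hdeg, show (D * (1 - 1 / n)) ^ 2 = (1 - 1 / (n : ℝ)) ^ 2 * D ^ 2 by ring]
    refine mul_le_mul_of_nonneg_right ?_ (sq_nonneg D)
    nlinarith
  set μ := SimpleGraph.binomialRandom (Fin n) p with hμ
  have hμp : IsProbabilityMeasure μ :=
    inferInstanceAs (IsProbabilityMeasure (SimpleGraph.binomialRandom (Fin n) p))
  have hδ0 : 0 < ((n : ℝ) ^ 2)⁻¹ := by positivity
  -- In the second case Δ² ≥ n/800, so 400nΔ² ≥ n²/2 and the event is the whole space.
  rcases le_or_gt (D ^ 2) (n / 100) with hD2 | hD2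
  · have hcard : ((Fintype.card (Fin n) : ℕ) : ℝ) = n := by simp
    have hbad := real_not_regular_le (V := Fin n) p (D := D) (L := Real.log n)
      (by rw [hcard]) hL hDL (by rwa [hcard]) (by rw [hcard, Real.exp_log hnpos])
    rw [hcard] at hbad
    have hexp : Real.exp (-(8 * Real.log n)) = ((n : ℝ) ^ 8)⁻¹ := by
      rw [Real.exp_neg, show (8 : ℝ) * Real.log n = ((8 : ℕ) : ℝ) * Real.log n by norm_num,
        Real.exp_nat_mul, Real.exp_log hnpos]
    rw [hexp] at hbad
    have hsmall : 4 * (n : ℝ) ^ 3 * ((n : ℝ) ^ 8)⁻¹ ≤ ((n : ℝ) ^ 2)⁻¹ := by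
      have h1 : 4 * (n : ℝ) ^ 3 * ((n : ℝ) ^ 8)⁻¹ = 4 / n ^ 3 * ((n : ℝ) ^ 2)⁻¹ := by
        field_simp
      rw [h1]
      refine mul_le_of_le_one_left hδ0.le ?_
      rw [div_le_one (by positivity)]
      have : (n : ℝ) ≤ n ^ 3 := le_self_pow₀ (by linarith) (by norm_num)
      linarith
    have hcompl := probReal_compl_eq_one_sub (μ := μ)
      (MeasurableSet.of_discrete (s := {G : SimpleGraph (Fin n) | ¬ Regular D G}))
    refine le_trans (by linarith) (hcompl.symm.le.trans (measureReal_mono ?_ (measure_ne_top _ _)))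
    intro G hG
    have hG : Regular D G := not_not.1 hG
    have hcount := choose_le_ncard_wellWitnessed_add (G := G)
      (t := (1 / 2 - 0) * (n / expDeg n p ^ 2)) (fun u v hne hadj => by
        refine le_trans ?_ (hG.le_ncard_witnesses hD0 (by rwa [hcard]) hne hadj)
        rw [hcard]
        have h1 : n / expDeg n p ^ 2 ≤ n / (99 / 100 * D ^ 2) :=
          div_le_div_of_nonneg_left hnpos.le (by positivity) hsq
        have h2 : n / (99 / 100 * D ^ 2) = 100 / 99 * (n / D ^ 2) := by
          field_simp
        have h3 : 0 < n / D ^ 2 := by positivity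
        linarith)
    have hedge := ncard_edgeSet_le (G := G) (b := sphereBound D 1)
      (fun v => hG.sphere_le v 1 (by simp; omega))
    rw [hcard] at hedge
    rw [Fintype.card_fin] at hcount
    have hcount' : (n.choose 2 : ℝ) ≤
        ((wellWitnessed G ((1 / 2 - 0) * (n / expDeg n p ^ 2))).ncard : ℝ) + G.edgeSet.ncard := by
      exact_mod_cast hcount
    have hb : sphereBound D 1 ≤ 400 * expDeg n p ^ 2 := by
      rw [sphereBound]
      nlinarith
    have hb2 : (n : ℝ) * sphereBound D 1 ≤ n * (400 * expDeg n p ^ 2) :=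
      mul_le_mul_of_nonneg_left hb hnpos.le
    simp only [Set.mem_ofPred_eq]
    linarith
  · have huniv : {G : SimpleGraph (Fin n) |
        (n.choose 2 : ℝ) - 400 * (n * expDeg n p ^ 2) ≤
          ((wellWitnessed G ((1 / 2 - 0) * (n / expDeg n p ^ 2))).ncard : ℝ)} = Set.univ := by
      refine Set.eq_univ_of_forall fun G => ?_
      have h1 : (n.choose 2 : ℝ) ≤ n ^ 2 / 2 := by
        rw [Nat.cast_choose_two]
        nlinarith
      have h2 : (0 : ℝ) ≤
        ((wellWitnessed G ((1 / 2 - 0) * (n / expDeg n p ^ 2))).ncard : ℝ) := Nat.cast_nonneg _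
      have h3 : (n : ℝ) * (n / 800) ≤ n * expDeg n p ^ 2 :=
        mul_le_mul_of_nonneg_left (by linarith) hnpos.le
      simp only [Set.mem_ofPred_eq]
      nlinarith
    rw [huniv, probReal_univ]
    linarith

theorem mainTheorem2 :
    ∃ (C : ℝ) (η δ : ℕ → ℝ),
      Tendsto η atTop (𝓝 0) ∧
      δ =o[atTop] (fun n : ℕ => ((n : ℝ))⁻¹) ∧
      ∀ (ε : ℝ), 0 ≤ ε → ∀ (n : ℕ), 2 ≤ n → ∀ (p : unitInterval),
        2000 * Real.log n / n ≤ (p : ℝ) →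
        (p : ℝ) ≤ (n : ℝ) ^ (-(1 / 2 : ℝ) - ε) →
        1 - δ n ≤ (SimpleGraph.binomialRandom (Fin n) p).real
          {G : SimpleGraph (Fin n) |
            (n.choose 2 : ℝ) - C * (n * RandomGraphWitness.expDeg n p ^ 2) ≤
              ((RandomGraphWitness.wellWitnessed G
                ((1 / 2 - η n) * (n / RandomGraphWitness.expDeg n p ^ 2))).ncard : ℝ)} := by
  -- For n < 1000 the value δ = 1 makes the bound trivial; only large n matters for δ = o(1/n).
  refine ⟨400, fun _ => 0, fun n => if n < 1000 then 1 else ((n : ℝ) ^ 2)⁻¹, tendsto_const_nhds,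
    ?_, ?_⟩
  · have h1 : (fun n : ℕ => ((n : ℝ) ^ 2)⁻¹) =o[atTop] (fun n : ℕ => ((n : ℝ))⁻¹) := by
      have h2 : (fun n : ℕ => ((n : ℝ))⁻¹) =o[atTop] (fun _ : ℕ => (1 : ℝ)) :=
        (isLittleO_one_iff ℝ).2 tendsto_inv_atTop_nhds_zero_nat
      have h3 := h2.mul_isBigO (isBigO_refl (fun n : ℕ => ((n : ℝ))⁻¹) atTop)
      refine h3.congr (fun n => ?_) (fun n => one_mul _)
      rw [sq, mul_inv]
    refine h1.congr' ?_ EventuallyEq.rfl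
    filter_upwards [eventually_ge_atTop 1000] with n hn
    rw [if_neg (by omega)]
  · intro ε _ n _ p hp _
    by_cases hn : n < 1000
    · simp only [hn, if_true, sub_self]
      exact MeasureTheory.measureReal_nonneg
    · simp only [hn, if_false]
      exact one_sub_le_real_wellWitnessed (by omega) p hp
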